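/- Let $d$ be a non-negative integer and let $\Lambda$ be a lattice in $\mathbb{R}^d$ (a discrete subgroup that spans $\mathbb{R}^d$ over $\mathbb{R}$). Let $OC(\Lambda)$ be the set of all linear isometries $R\in O(d)$ for which $\Lambda\cap R\Lambda$ has full rank $d$. Let $\Gamma_0$ be an orthogonal lattice, i.e. the $\mathbb{Z}$-span of an orthogonal (not necessarily orthonormal) basis of $\mathbb{R}^d$, and let $G=\{R\in O(d): R\Gamma_0=\Gamma_0\}$ be its symmetry group. If $G\subseteq OC(\Lambda)$, then $\Lambda$ has a well-rounded sublattice: there is a lattice $\Gamma\subseteq\Lambda$ in $\mathbb{R}^d$ whose non-zero vectors of minimal length span $\mathbb{R}^d$ over $\mathbb{R}$. -/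

import Mathlib

/-- The image `R Λ` of an additive subgroup `Λ` of `ℝ^d` under a linear isometry `R ∈ O(d)`. -/
noncomputable def latticeImage {d : ℕ}
    (R : EuclideanSpace ℝ (Fin d) ≃ₗᵢ[ℝ] EuclideanSpace ℝ (Fin d))
    (Λ : Submodule ℤ (EuclideanSpace ℝ (Fin d))) :
    Submodule ℤ (EuclideanSpace ℝ (Fin d)) :=
  Λ.map (R.toLinearEquiv.toLinearMap.restrictScalars ℤ)

/-- `OC(Λ)`: the linear isometries `R ∈ O(d)` for which `Λ ∩ R Λ` has full rank `d`,
that is, spans `ℝ^d` over `ℝ` (discreteness is inherited from `Λ`). -/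
def coincidenceIsometries {d : ℕ} (Λ : Submodule ℤ (EuclideanSpace ℝ (Fin d))) :
    Set (EuclideanSpace ℝ (Fin d) ≃ₗᵢ[ℝ] EuclideanSpace ℝ (Fin d)) :=
  {R | Submodule.span ℝ
    ((Λ ⊓ latticeImage R Λ : Submodule ℤ (EuclideanSpace ℝ (Fin d))) :
      Set (EuclideanSpace ℝ (Fin d))) = ⊤}

theorem latticeImage_one {d : ℕ} (Λ : Submodule ℤ (EuclideanSpace ℝ (Fin d))) :
    latticeImage 1 Λ = Λ := by
  ext x
  simp [latticeImage]

theorem latticeImage_mul {d : ℕ}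
    (R S : EuclideanSpace ℝ (Fin d) ≃ₗᵢ[ℝ] EuclideanSpace ℝ (Fin d))
    (Λ : Submodule ℤ (EuclideanSpace ℝ (Fin d))) :
    latticeImage (R * S) Λ = latticeImage R (latticeImage S Λ) := by
  ext x
  simp [latticeImage]

/-- The symmetry (point) group of `Γ`: the linear isometries `R ∈ O(d)` with `R Γ = Γ`. -/
noncomputable def latticeSymmetryGroup {d : ℕ} (Γ : Submodule ℤ (EuclideanSpace ℝ (Fin d))) :
    Subgroup (EuclideanSpace ℝ (Fin d) ≃ₗᵢ[ℝ] EuclideanSpace ℝ (Fin d)) where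
  carrier := {R | latticeImage R Γ = Γ}
  one_mem' := latticeImage_one Γ
  mul_mem' := by
    intro R S hR hS
    simp only [Set.mem_ofPred_eq] at hR hS ⊢
    rw [latticeImage_mul, hS, hR]
  inv_mem' := by
    intro R hR
    simp only [Set.mem_ofPred_eq] at hR ⊢
    conv_lhs => rw [← hR]
    rw [← latticeImage_mul, inv_mul_cancel, latticeImage_one]

/-- An orthogonal lattice: the `ℤ`-span of an orthogonal (not necessarily orthonormal) basis
of `ℝ^d`. -/
def IsOrthogonalLattice {d : ℕ} (Γ : Submodule ℤ (EuclideanSpace ℝ (Fin d))) : Prop :=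
  ∃ b : Module.Basis (Fin d) ℝ (EuclideanSpace ℝ (Fin d)),
    (∀ i j, i ≠ j → inner ℝ (b i) (b j) = 0) ∧ Γ = Submodule.span ℤ (Set.range b)

/-- The non-zero vectors of `Γ` of minimal length. -/
def minimalVectors {d : ℕ} (Γ : Submodule ℤ (EuclideanSpace ℝ (Fin d))) :
    Set (EuclideanSpace ℝ (Fin d)) :=
  {x | x ∈ Γ ∧ x ≠ 0 ∧ ∀ y ∈ Γ, y ≠ 0 → ‖x‖ ≤ ‖y‖}

/-- `Γ` is well-rounded: its non-zero vectors of minimal length span `ℝ^d` over `ℝ`. -/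
def IsWellRounded {d : ℕ} (Γ : Submodule ℤ (EuclideanSpace ℝ (Fin d))) : Prop :=
  Submodule.span ℝ (minimalVectors Γ) = ⊤

/-! The reflection `R` in the hyperplane orthogonal to a basis vector `b i` of `Γ₀` lies in `G`,
hence in `OC(Λ)`. For suitable `x ∈ Λ` with `R x ∈ Λ`, the difference `x - R x` is a non-zero
multiple of `b i` in `Λ`, so `Λ` contains an orthogonal basis `v`.

It remains to treat an orthogonal lattice (`exists_isWellRounded_le_of_orthogonal`). Rows of a sign
matrix `t` give vectors `∑ i, t j i * a i • v i` of one common length, spanning when `t` has trivial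
kernel. An integer combination with no zero coordinate is at least as long; only those with some
zero coordinates could be shorter. `HasRoundSignMatrix` demands that these be longer by a factor `4
/ 3` in a weighted squared norm, and this slack lets integers `a i` imitate the real weights. Such
matrices exist in every dimension by induction, gluing a Sylvester matrix to a smaller one
(`HasRoundSignMatrix.sum`). -/

/-! ### Round sign matrices in every dimension -/

/-- A square sign matrix `t` with trivial kernel, together with positive weights for which
every integer combination of its rows is zero, nowhere zero, or has weighted squared norm at least
`4 / 3` times that of a sign vector. -/
def HasRoundSignMatrix (ι : Type) [Fintype ι] : Prop :=
  ∃ (w : ι → ℝ) (t : ι → ι → ℤ), (∀ i, 0 < w i) ∧ (∀ i j, t i j = 1 ∨ t i j = -1) ∧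
    (∀ y : ι → ℝ, (∀ j, ∑ i, (t j i : ℝ) * y i = 0) → y = 0) ∧
    ∀ c : ι → ℤ, (∀ i, ∑ j, c j * t j i = 0) ∨ (∀ i, ∑ j, c j * t j i ≠ 0) ∨
      4 / 3 * ∑ i, w i ≤ ∑ i, w i * ((∑ j, c j * t j i : ℤ) : ℝ) ^ 2

theorem HasRoundSignMatrix.congr {ι κ : Type} [Fintype ι] [Fintype κ] (e : ι ≃ κ)
    (h : HasRoundSignMatrix ι) : HasRoundSignMatrix κ := by
  obtain ⟨w, t, hw, ht, hinj, hc⟩ := h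
  refine ⟨fun k => w (e.symm k), fun k l => t (e.symm k) (e.symm l), fun _ => hw _,
    fun _ _ => ht _ _, fun y hy => ?_, fun c => ?_⟩
  · have h0 := hinj (fun i => y (e i)) fun j => by
      have := hy (e j)
      rw [← e.sum_comp] at this
      simpa using this
    funext k
    simpa using congrFun h0 (e.symm k)
  · have key : ∀ i, ∑ k, c k * t (e.symm k) i = ∑ j, c (e j) * t j i := fun i => by
      rw [← e.sum_comp]; simp
    simp only [key]
    rcases hc (fun j => c (e j)) with h | h | h
    · exact Or.inl fun _ => h _
    · exact Or.inr (Or.inl fun _ => h _)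
    · refine Or.inr (Or.inr ?_)
      rw [← e.sum_comp, ← e.sum_comp]
      simpa using h

/-- Sylvester's Hadamard matrix, indexed by the cube. -/
def sylvester {m : ℕ} (a b : Fin m → Bool) : ℤ :=
  ∏ i, if a i && b i then -1 else 1

theorem sylvester_comm {m : ℕ} (a b : Fin m → Bool) : sylvester a b = sylvester b a := by
  simp [sylvester, Bool.and_comm]

theorem sylvester_eq_one_or {m : ℕ} (a b : Fin m → Bool) :
    sylvester a b = 1 ∨ sylvester a b = -1 := by
  unfold sylvester
  refine Finset.prod_induction _ (fun z : ℤ => z = 1 ∨ z = -1) ?_ (Or.inl rfl) ?_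
  · rintro x y (rfl | rfl) (rfl | rfl) <;> simp
  · intro i _
    split_ifs <;> simp

theorem sum_sylvester_mul {m : ℕ} (a a' : Fin m → Bool) :
    ∑ b, sylvester a b * sylvester a' b = if a = a' then 2 ^ m else 0 := by
  simp only [sylvester, ← Finset.prod_mul_distrib]
  have := Finset.prod_univ_sum (fun _ : Fin m => (Finset.univ : Finset Bool))
    (fun i c => (if a i && c then (-1 : ℤ) else 1) * (if a' i && c then -1 else 1))
  rw [Fintype.piFinset_univ] at this
  rw [← this]
  have hf : ∀ i, ∑ c : Bool, (if a i && c then (-1 : ℤ) else 1) * (if a' i && c then -1 else 1)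
      = if a i = a' i then 2 else 0 := by
    intro i
    cases a i <;> cases a' i <;> simp
  simp only [hf]
  split_ifs with h
  · simp [h]
  · obtain ⟨i, hi⟩ := Function.ne_iff.mp h
    exact Finset.prod_eq_zero (Finset.mem_univ i) (by simp [hi])

theorem sum_sq_sum_mul_sylvester {m : ℕ} (c : (Fin m → Bool) → ℝ) :
    ∑ b, (∑ a, c a * sylvester a b) ^ 2 = 2 ^ m * ∑ a, c a ^ 2 := by
  have key : ∀ a a' : Fin m → Bool, ∑ b, (sylvester a b : ℝ) * sylvester a' b
      = if a = a' then 2 ^ m else 0 := fun a a' => by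
    exact_mod_cast congrArg (Int.cast : ℤ → ℝ) (sum_sylvester_mul a a')
  calc ∑ b, (∑ a, c a * sylvester a b) ^ 2
      = ∑ b, ∑ a, ∑ a', c a * c a' * (sylvester a b * sylvester a' b) := by
        refine Finset.sum_congr rfl fun b _ => ?_
        rw [sq, Finset.sum_mul_sum]
        refine Finset.sum_congr rfl fun a _ => Finset.sum_congr rfl fun a' _ => by ring
    _ = ∑ a, ∑ a', c a * c a' * ∑ b, (sylvester a b : ℝ) * sylvester a' b := by
        rw [Finset.sum_comm]
        refine Finset.sum_congr rfl fun a _ => ?_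
        rw [Finset.sum_comm]
        refine Finset.sum_congr rfl fun a' _ => ?_
        rw [Finset.mul_sum]
    _ = 2 ^ m * ∑ a, c a ^ 2 := by
        simp only [key, mul_ite, mul_zero, Finset.sum_ite_eq, Finset.mem_univ, if_true]
        rw [Finset.mul_sum]
        exact Finset.sum_congr rfl fun a _ => by ring

theorem Int.eq_zero_or_single_or_two_le_sum_sq {ι : Type*} [Fintype ι] [DecidableEq ι]
    (c : ι → ℤ) :
    c = 0 ∨ (∃ i, c = Pi.single i 1 ∨ c = Pi.single i (-1)) ∨ 2 ≤ ∑ i, c i ^ 2 := by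
  by_cases h0 : c = 0
  · exact Or.inl h0
  obtain ⟨i, hi⟩ := Function.ne_iff.mp h0
  simp only [Pi.zero_apply] at hi
  refine Or.inr (or_iff_not_imp_right.mpr fun h2 => ?_)
  rw [← Finset.add_sum_erase _ _ (Finset.mem_univ i)] at h2
  have hpos : ∀ j ∈ Finset.univ.erase i, 0 ≤ c j ^ 2 := fun j _ => sq_nonneg _
  have hs := Finset.sum_nonneg hpos
  have hi1 : 0 < c i ^ 2 := by positivity
  have hz := (Finset.sum_eq_zero_iff_of_nonneg hpos).mp (by omega)
  have hj : ∀ j, j ≠ i → c j = 0 := fun j hj => by simpa using hz j (by simp [hj])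
  have h1 : c i = 1 ∨ c i = -1 := by
    rw [← sq_eq_sq_iff_eq_or_eq_neg]
    omega
  refine ⟨i, h1.imp ?_ ?_⟩ <;>
  · intro h
    funext j
    by_cases hji : j = i
    · subst hji; simp [h]
    · simp [hj j hji, hji]

/-- With `H` the Sylvester matrix, the rows are `(H a, t (φ a))` and `(H (e k), -t k)`. The old
weights total `B` and the cube gets `2 * B`, so the bound to reach is `4 / 3 * 3 * B = 4 * B`. -/
theorem HasRoundSignMatrix.sum {m : ℕ} {κ : Type} [Fintype κ] [Nonempty κ]
    (e : κ ↪ (Fin m → Bool)) (h : HasRoundSignMatrix κ) :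
    HasRoundSignMatrix ((Fin m → Bool) ⊕ κ) := by
  classical
  obtain ⟨w, t, hw, ht, hinj, hc⟩ := h
  obtain ⟨φ, hφ⟩ : ∃ φ : (Fin m → Bool) → κ, ∀ k, φ (e k) = k :=
    ⟨Function.invFun e, Function.leftInverse_invFun e.injective⟩
  set B := ∑ k, w k with hB
  have hBpos : 0 < B := Finset.sum_pos (fun k _ => hw k) Finset.univ_nonempty
  refine ⟨Sum.elim (fun _ => 2 * B / 2 ^ m) w,
    Sum.elim (fun a => Sum.elim (sylvester a) (t (φ a)))
      (fun k => Sum.elim (sylvester (e k)) (fun l => -t k l)), ?_, ?_, ?_, ?_⟩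
  · rintro (a | k)
    · simp only [Sum.elim_inl]; positivity
    · exact hw k
  · rintro (a | k) (b | l)
    · exact sylvester_eq_one_or _ _
    · exact ht _ _
    · exact sylvester_eq_one_or _ _
    · have := ht k l
      simp only [Sum.elim_inr]
      omega
  · intro y hy
    have h1 := fun a => hy (Sum.inl a)
    have h2 := fun k => hy (Sum.inr k)
    simp only [Fintype.sum_sum_type, Sum.elim_inl, Sum.elim_inr, Int.cast_neg, neg_mul,
      Finset.sum_neg_distrib] at h1 h2
    -- The rows of `e k` and of `k` agree on the cube and are opposite on `κ`, so their difference
    -- isolates `t k`.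
    have hr : (fun k => y (Sum.inr k)) = 0 := hinj _ fun k => by
      have := h1 (e k)
      rw [hφ] at this
      linarith [h2 k]
    have hr' : ∀ k, y (Sum.inr k) = 0 := fun k => congrFun hr k
    simp only [hr', mul_zero, Finset.sum_const_zero, add_zero] at h1
    have hP := sum_sq_sum_mul_sylvester fun a => y (Sum.inl a)
    have hz : ∀ b, ∑ a, y (Sum.inl a) * (sylvester a b : ℝ) = 0 := fun b => by
      rw [← h1 b]
      exact Finset.sum_congr rfl fun a _ => by rw [mul_comm, sylvester_comm]
    simp only [hz] at hP
    have hs : ∑ a, y (Sum.inl a) ^ 2 = 0 := by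
      have : (0 : ℝ) < 2 ^ m := by positivity
      simp only [ne_eq, OfNat.ofNat_ne_zero, not_false_eq_true, zero_pow,
        Finset.sum_const_zero] at hP
      exact (mul_eq_zero.mp hP.symm).resolve_left this.ne'
    rw [Finset.sum_eq_zero_iff_of_nonneg fun _ _ => sq_nonneg _] at hs
    funext s
    rcases s with a | k
    · simpa using hs a (Finset.mem_univ _)
    · exact hr' k
  · intro c
    -- Rows with the same cube part are merged: `C` determines the cube coordinates of the
    -- combination.
    set C : (Fin m → Bool) → ℤ := fun a =>
      c (Sum.inl a) + ∑ k, if e k = a then c (Sum.inr k) else 0 with hC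
    have hsum : ∀ f : (Fin m → Bool) → ℤ, ∑ a, C a * f a
        = ∑ a, c (Sum.inl a) * f a + ∑ k, c (Sum.inr k) * f (e k) := by
      intro f
      simp only [hC, add_mul, Finset.sum_add_distrib, Finset.sum_mul]
      congr 1
      rw [Finset.sum_comm]
      simp
    have hx : ∀ b, ∑ a, c (Sum.inl a) * sylvester a b + ∑ k, c (Sum.inr k) * sylvester (e k) b
        = ∑ a, C a * sylvester a b := fun b => (hsum fun a => sylvester a b).symm
    have hy : ∀ l, ∑ a, c (Sum.inl a) * t (φ a) l + ∑ k, c (Sum.inr k) * -t k l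
        = ∑ a, C a * t (φ a) l - 2 * ∑ k, c (Sum.inr k) * t k l := by
      intro l
      rw [hsum fun a => t (φ a) l]
      simp only [hφ, mul_neg, Finset.sum_neg_distrib]
      ring
    have hm : (0 : ℝ) < 2 ^ m := by positivity
    have htot : ∑ _a : Fin m → Bool, 2 * B / 2 ^ m = 2 * B := by
      simp only [Finset.sum_const, Finset.card_univ, Fintype.card_pi, Fintype.card_bool,
        Finset.prod_const, Fintype.card_fin, nsmul_eq_mul, Nat.cast_pow, Nat.cast_ofNat]
      field_simp
    simp only [Sum.forall, Fintype.sum_sum_type, Sum.elim_inl, Sum.elim_inr, hx, hy, htot]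
    rcases Int.eq_zero_or_single_or_two_le_sum_sq C with h0 | ⟨a, ha⟩ | h2
    -- Only the `κ` part survives, and it is twice an old combination: zero, or of squared norm at
    -- least `4 * B`.
    · simp only [h0, Pi.zero_apply, zero_mul, Finset.sum_const_zero, zero_sub]
      have hb := hc fun k => c (Sum.inr k)
      have hge : (∀ l, ∑ k, c (Sum.inr k) * t k l = 0) ∨
          B ≤ ∑ l, w l * ((∑ k, c (Sum.inr k) * t k l : ℤ) : ℝ) ^ 2 := by
        rcases hb with h | h | h
        · exact Or.inl h
        · refine Or.inr (Finset.sum_le_sum fun l _ => ?_)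
          refine le_mul_of_one_le_right (hw l).le ?_
          have h1 : 0 < (∑ k, c (Sum.inr k) * t k l) ^ 2 := by
            have := h l
            positivity
          exact_mod_cast h1
        · exact Or.inr (by linarith)
      rcases hge with h | h
      · exact Or.inl ⟨fun _ => trivial, fun l => by rw [h l]; rfl⟩
      · refine Or.inr (Or.inr ?_)
        have he : ∑ l, w l * ((-(2 * ∑ k, c (Sum.inr k) * t k l) : ℤ) : ℝ) ^ 2
            = 4 * ∑ l, w l * ((∑ k, c (Sum.inr k) * t k l : ℤ) : ℝ) ^ 2 := by
          rw [Finset.mul_sum]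
          refine Finset.sum_congr rfl fun l _ => ?_
          push_cast
          ring
        rw [he]
        simp only [Int.cast_zero, ne_eq, OfNat.ofNat_ne_zero, not_false_eq_true, zero_pow,
          mul_zero, Finset.sum_const_zero, zero_add]
        linarith
    · refine Or.inr (Or.inl ⟨fun b => ?_, fun l => ?_⟩)
      · have := sylvester_eq_one_or a b
        rcases ha with ha | ha <;> simp [ha, Pi.single_apply] <;> omega
      -- Parity: the coordinate is `±1` minus an even number.
      · have := ht (φ a) l
        have hs : ∑ a, C a * t (φ a) l = t (φ a) l ∨ ∑ a, C a * t (φ a) l = -t (φ a) l := by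
          rcases ha with ha | ha <;> simp [ha, Pi.single_apply]
        omega
    -- By Parseval the cube part alone contributes `2 * B * ∑ C ^ 2 ≥ 4 * B`.
    · refine Or.inr (Or.inr ?_)
      have hP := sum_sq_sum_mul_sylvester fun a => (C a : ℝ)
      have h2' : (2 : ℝ) ≤ ∑ a, (C a : ℝ) ^ 2 := by exact_mod_cast h2
      have hl : ∑ b, 2 * B / 2 ^ m * ((∑ a, C a * sylvester a b : ℤ) : ℝ) ^ 2
          = 2 * B * ∑ a, (C a : ℝ) ^ 2 := by
        rw [← Finset.mul_sum]
        push_cast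
        rw [hP]
        field_simp
      rw [hl]
      have hn : 0 ≤ ∑ l, w l *
          ((∑ a, C a * t (φ a) l - 2 * ∑ k, c (Sum.inr k) * t k l : ℤ) : ℝ) ^ 2 :=
        Finset.sum_nonneg fun l _ => mul_nonneg (hw l).le (sq_nonneg _)
      nlinarith

theorem hasRoundSignMatrix_fin (d : ℕ) : HasRoundSignMatrix (Fin d) := by
  induction d using Nat.strong_induction_on with
  | _ d ih =>
    rcases Nat.lt_or_ge d 2 with hd | hd
    · have : Subsingleton (Fin d) := by
        rw [Fin.subsingleton_iff_le_one]; omega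
      refine ⟨fun _ => 1, fun _ _ => 1, fun _ => one_pos, fun _ _ => Or.inl rfl,
        fun y hy => ?_, fun c => ?_⟩
      · funext i
        have := hy i
        rw [Fintype.sum_subsingleton _ i] at this
        simpa using this
      · by_cases h : ∑ j, c j * 1 = 0
        · exact Or.inl fun _ => h
        · exact Or.inr (Or.inl fun _ => h)
    -- The logarithm of `d - 1`, not `d`, gives `1 ≤ d - 2 ^ m ≤ 2 ^ m`, so the second block is
    -- non-empty even when `d` is a power of two.
    · have h1 : 2 ^ Nat.log 2 (d - 1) ≤ d - 1 := Nat.pow_log_le_self 2 (by omega)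
      have h2 : d - 1 < 2 ^ (Nat.log 2 (d - 1) + 1) := Nat.lt_pow_succ_log_self (by norm_num) _
      set m := Nat.log 2 (d - 1)
      rw [pow_succ] at h2
      have hpos : 0 < 2 ^ m := by positivity
      have : Nonempty (Fin (d - 2 ^ m)) := ⟨⟨0, by omega⟩⟩
      obtain ⟨e⟩ : Nonempty (Fin (d - 2 ^ m) ↪ (Fin m → Bool)) :=
        Function.Embedding.nonempty_of_card_le (by simp; omega)
      exact ((ih (d - 2 ^ m) (by omega)).sum e).congr
        (Fintype.equivFinOfCardEq (by simp; omega))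

/-! ### Approximating weights by integer multiples -/

theorem exists_nat_mul_sq_approx {ι : Type*} [Finite ι] (c w : ι → ℝ) (hc : ∀ i, 0 < c i)
    (hw : ∀ i, 0 < w i) :
    ∃ (a : ι → ℕ) (M : ℝ), 0 < M ∧ ∀ i, 0 < a i ∧
      M * w i ≤ (a i * c i) ^ 2 ∧ (a i * c i) ^ 2 ≤ 4 / 3 * (M * w i) := by
  have := Fintype.ofFinite ι
  -- Rounding up costs at most `c i`, at most an eighth of `K * √(w i)`, and `(9 / 8) ^ 2 ≤ 4 / 3`.
  obtain ⟨N, hN⟩ : ∃ N : ℝ, ∀ i, 8 * c i / √(w i) ≤ N :=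
    (Set.finite_range fun i => 8 * c i / √(w i)).bddAbove.imp
      fun N hN i => hN (Set.mem_range_self i)
  set K := max N 1
  have hK : 0 < K := lt_of_lt_of_le one_pos (le_max_right _ _)
  refine ⟨fun i => ⌈K * √(w i) / c i⌉₊, K ^ 2, by positivity, fun i => ?_⟩
  have hs : 0 < √(w i) := Real.sqrt_pos.mpr (hw i)
  have hi := hc i
  have hq : 0 < K * √(w i) / c i := by positivity
  have h1 : K * √(w i) ≤ ⌈K * √(w i) / c i⌉₊ * c i := by
    rw [← div_le_iff₀ hi]; exact Nat.le_ceil _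
  have h2 : ⌈K * √(w i) / c i⌉₊ * c i ≤ K * √(w i) + c i := by
    have := (Nat.ceil_lt_add_one hq.le).le
    calc _ ≤ (K * √(w i) / c i + 1) * c i := by gcongr
      _ = _ := by field_simp
  have h3 : 8 * c i ≤ K * √(w i) := by
    rw [← div_le_iff₀ hs]; exact (hN i).trans (le_max_left _ _)
  have hsq : K ^ 2 * w i = (K * √(w i)) ^ 2 := by rw [mul_pow, Real.sq_sqrt (hw i).le]
  have h0 : 0 < K * √(w i) := by positivity
  refine ⟨Nat.ceil_pos.mpr hq, ?_, ?_⟩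
  · rw [hsq]; gcongr
  · rw [hsq]
    nlinarith

/-! ### Reflections as coincidence isometries -/

theorem exists_mem_inner_ne_zero_of_span_eq_top {E : Type*} [NormedAddCommGroup E]
    [InnerProductSpace ℝ E] {s : Set E} (hs : Submodule.span ℝ s = ⊤) {b : E} (hb : b ≠ 0) :
    ∃ x ∈ s, inner ℝ b x ≠ 0 := by
  by_contra! h
  have hle : Submodule.span ℝ s ≤ (ℝ ∙ b)ᗮ :=
    Submodule.span_le.mpr fun x hx => Submodule.mem_orthogonal_singleton_iff_inner_right.mpr (h x hx)
  rw [hs] at hle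
  exact hb (inner_self_eq_zero.mp
    (Submodule.mem_orthogonal_singleton_iff_inner_right.mp (hle (Submodule.mem_top (x := b)))))

theorem mem_latticeSymmetryGroup_of_involutive {d : ℕ}
    {Γ : Submodule ℤ (EuclideanSpace ℝ (Fin d))}
    {R : EuclideanSpace ℝ (Fin d) ≃ₗᵢ[ℝ] EuclideanSpace ℝ (Fin d)} (hR : Function.Involutive R)
    (hle : latticeImage R Γ ≤ Γ) : R ∈ latticeSymmetryGroup Γ := by
  have hge : latticeImage R (latticeImage R Γ) ≤ latticeImage R Γ := Submodule.map_mono hle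
  rw [← latticeImage_mul, show R * R = 1 from LinearIsometryEquiv.ext hR,
    latticeImage_one] at hge
  exact le_antisymm hle hge

theorem reflection_mem_latticeSymmetryGroup {d : ℕ}
    (b : Module.Basis (Fin d) ℝ (EuclideanSpace ℝ (Fin d)))
    (hb : ∀ i j, i ≠ j → inner ℝ (b i) (b j) = 0) (i : Fin d) :
    (ℝ ∙ b i)ᗮ.reflection ∈ latticeSymmetryGroup (Submodule.span ℤ (Set.range b)) := by
  refine mem_latticeSymmetryGroup_of_involutive
    (Submodule.reflection_involutive _) ?_
  rw [latticeImage, Submodule.map_span, Submodule.span_le]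
  rintro _ ⟨_, ⟨j, rfl⟩, rfl⟩
  have hj : b j ∈ Submodule.span ℤ (Set.range b) := Submodule.subset_span (Set.mem_range_self j)
  suffices h : (ℝ ∙ b i)ᗮ.reflection (b j) ∈ Submodule.span ℤ (Set.range b) from h
  by_cases hij : i = j
  · subst hij
    rw [Submodule.reflection_orthogonalComplement_singleton_eq_neg]
    exact neg_mem hj
  · rwa [Submodule.reflection_mem_subspace_eq_self
      (Submodule.mem_orthogonal_singleton_iff_inner_right.mpr (hb i j hij))]

/-- A lattice for which the reflection in `bᗮ` is a coincidence isometry meets the line `ℝ b`. -/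
theorem exists_smul_mem_of_reflection_mem {d : ℕ} {Λ : Submodule ℤ (EuclideanSpace ℝ (Fin d))}
    {b : EuclideanSpace ℝ (Fin d)} (hb : b ≠ 0)
    (h : (ℝ ∙ b)ᗮ.reflection ∈ coincidenceIsometries Λ) :
    ∃ r : ℝ, r ≠ 0 ∧ r • b ∈ Λ := by
  obtain ⟨x, ⟨hx, y, hy, hyx⟩, hne⟩ := exists_mem_inner_ne_zero_of_span_eq_top h hb
  have hRx : (ℝ ∙ b)ᗮ.reflection x = y := by
    rw [← hyx]
    exact Submodule.reflection_reflection _ y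
  -- This multiple of `b` is `x` minus its reflection.
  refine ⟨2 * (inner ℝ b x / ‖b‖ ^ 2), ?_, ?_⟩
  · have : ‖b‖ ≠ 0 := norm_ne_zero_iff.mpr hb
    positivity
  · have hxy := sub_mem hx hy
    rw [← hRx, Submodule.reflection_orthogonal_apply, Submodule.reflection_singleton_apply] at hxy
    convert hxy using 1
    simp only [RCLike.ofReal_real_eq_id, id]
    module

/-! ### Well-rounded sublattices from orthogonal vectors -/

theorem norm_sq_sum_smul_of_orthogonal {ι E : Type*} [Fintype ι] [NormedAddCommGroup E]
    [InnerProductSpace ℝ E] {v : ι → E} (hv : ∀ i j, i ≠ j → inner ℝ (v i) (v j) = 0)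
    (c : ι → ℝ) : ‖∑ i, c i • v i‖ ^ 2 = ∑ i, c i ^ 2 * ‖v i‖ ^ 2 := by
  classical
  rw [← real_inner_self_eq_norm_sq, sum_inner]
  refine Finset.sum_congr rfl fun i _ => ?_
  rw [inner_sum, Finset.sum_eq_single i]
  · rw [real_inner_smul_left, real_inner_smul_right, real_inner_self_eq_norm_sq]; ring
  · intro j _ hj
    rw [real_inner_smul_left, real_inner_smul_right, hv i j hj.symm]; ring
  · simp

theorem exists_isWellRounded_le_of_orthogonal {d : ℕ}
    (Λ : Submodule ℤ (EuclideanSpace ℝ (Fin d))) [DiscreteTopology Λ]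
    (v : Fin d → EuclideanSpace ℝ (Fin d)) (hvΛ : ∀ i, v i ∈ Λ)
    (hv : ∀ i j, i ≠ j → inner ℝ (v i) (v j) = 0) (hv0 : ∀ i, v i ≠ 0)
    (hspan : Submodule.span ℝ (Set.range v) = ⊤) :
    ∃ Γ : Submodule ℤ (EuclideanSpace ℝ (Fin d)),
      Γ ≤ Λ ∧ (∃ _ : DiscreteTopology Γ, IsZLattice ℝ Γ) ∧ IsWellRounded Γ := by
  obtain ⟨w, t, hw, ht, hinj, hround⟩ := hasRoundSignMatrix_fin d
  obtain ⟨a, M, hM, ha⟩ := exists_nat_mul_sq_approx (fun i => ‖v i‖) w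
    (fun i => norm_pos_iff.mpr (hv0 i)) hw
  set g : Fin d → EuclideanSpace ℝ (Fin d) := fun j => ∑ i, (t j i * a i : ℤ) • v i with hg
  set Γ := Submodule.span ℤ (Set.range g)
  have hle : Γ ≤ Λ := Submodule.span_le.mpr <| by
    rintro _ ⟨j, rfl⟩
    exact sum_mem fun i _ => Λ.smul_mem _ (hvΛ i)
  have hgspan : Submodule.span ℝ (Set.range g) = ⊤ := by
    rw [← Submodule.orthogonal_eq_bot_iff, Submodule.eq_bot_iff]
    intro y hy
    have hy' : ∀ j, inner ℝ (g j) y = 0 := fun j =>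
      Submodule.inner_right_of_mem_orthogonal (Submodule.subset_span (Set.mem_range_self j)) hy
    have h0 := hinj (fun i => a i * inner ℝ (v i) y) fun j => by
      rw [← hy' j, hg, sum_inner]
      refine Finset.sum_congr rfl fun i _ => ?_
      rw [← Int.cast_smul_eq_zsmul ℝ, real_inner_smul_left]
      push_cast
      ring
    have hvy : ∀ i, inner ℝ (v i) y = 0 := fun i => by
      have hai : (a i : ℝ) ≠ 0 := by exact_mod_cast (ha i).1.ne'
      simpa [hai] using congrFun h0 i
    have hyy : y ∈ (Submodule.span ℝ (Set.range v))ᗮ := by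
      rw [Submodule.mem_orthogonal]
      intro u hu
      induction hu using Submodule.span_induction with
      | mem u hu => obtain ⟨i, rfl⟩ := hu; exact hvy i
      | zero => exact inner_zero_left _
      | add u u' _ _ h h' => rw [inner_add_left, h, h', add_zero]
      | smul r u _ h => rw [real_inner_smul_left, h, mul_zero]
    simpa [hspan] using hyy
  have hnorm : ∀ x : Fin d → ℤ, ‖∑ i, (x i * a i : ℤ) • v i‖ ^ 2
      = ∑ i, (a i * ‖v i‖) ^ 2 * (x i : ℝ) ^ 2 := by
    intro x
    simp only [← Int.cast_smul_eq_zsmul ℝ]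
    rw [norm_sq_sum_smul_of_orthogonal hv]
    refine Finset.sum_congr rfl fun i _ => ?_
    push_cast
    ring
  have hgnorm : ∀ j, ‖g j‖ ^ 2 = ∑ i, (a i * ‖v i‖) ^ 2 := fun j => by
    rw [hg, hnorm]
    refine Finset.sum_congr rfl fun i _ => ?_
    rcases ht j i with h | h <;> simp [h]
  have hmin : ∀ j, ∀ y ∈ Γ, y ≠ 0 → ‖g j‖ ≤ ‖y‖ := by
    intro j y hy hy0
    obtain ⟨c, rfl⟩ := (Submodule.mem_span_range_iff_exists_fun ℤ).mp hy
    have hyx : ∑ j, c j • g j = ∑ i, ((∑ j, c j * t j i) * a i : ℤ) • v i := by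
      simp only [hg, Finset.smul_sum, smul_smul]
      rw [Finset.sum_comm]
      refine Finset.sum_congr rfl fun i _ => ?_
      rw [← Finset.sum_smul, Finset.sum_mul]
      simp only [mul_assoc]
    rw [← sq_le_sq₀ (norm_nonneg _) (norm_nonneg _), hgnorm, hyx,
      hnorm fun i => ∑ j, c j * t j i]
    rcases hround c with h | h | h
    · exact absurd (by simp [hyx, h]) hy0
    · refine Finset.sum_le_sum fun i _ => le_mul_of_one_le_right (sq_nonneg _) ?_
      have h1 : 0 < (∑ j, c j * t j i) ^ 2 := by
        have := h i
        positivity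
      exact_mod_cast h1
    -- The factor `4 / 3` lost in approximating the weights is exactly the slack in `hround`.
    · calc ∑ i, (a i * ‖v i‖) ^ 2 ≤ ∑ i, 4 / 3 * (M * w i) :=
            Finset.sum_le_sum fun i _ => (ha i).2.2
        _ = M * (4 / 3 * ∑ i, w i) := by
            simp only [Finset.mul_sum]
            exact Finset.sum_congr rfl fun i _ => by ring
        _ ≤ M * ∑ i, w i * ((∑ j, c j * t j i : ℤ) : ℝ) ^ 2 := by gcongr
        _ = ∑ i, M * w i * ((∑ j, c j * t j i : ℤ) : ℝ) ^ 2 := by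
            simp only [Finset.mul_sum, mul_assoc]
        _ ≤ _ := Finset.sum_le_sum fun i _ =>
            mul_le_mul_of_nonneg_right (ha i).2.1 (sq_nonneg _)
  have hg0 : ∀ j, g j ≠ 0 := fun j hj => by
    have h := hgnorm j
    rw [hj, norm_zero, zero_pow two_ne_zero] at h
    have h' := (Finset.sum_eq_zero_iff_of_nonneg fun _ _ => sq_nonneg _).mp h.symm j
      (Finset.mem_univ j)
    have hpos := mul_pos hM (hw j)
    linarith [(ha j).2.1]
  have hdisc : DiscreteTopology Γ :=
    DiscreteTopology.of_subset (s := (Λ : Set (EuclideanSpace ℝ (Fin d)))) ‹_› hle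
  refine ⟨Γ, hle, ⟨hdisc, ⟨?_⟩⟩, ?_⟩
  · rw [eq_top_iff, ← hgspan]
    exact Submodule.span_mono Submodule.subset_span
  · rw [IsWellRounded, eq_top_iff, ← hgspan]
    refine Submodule.span_mono ?_
    rintro _ ⟨j, rfl⟩
    exact ⟨Submodule.subset_span ⟨j, rfl⟩, hg0 j, hmin j⟩

theorem theorem2 (d : ℕ)
    (Λ : Submodule ℤ (EuclideanSpace ℝ (Fin d))) [DiscreteTopology Λ] [IsZLattice ℝ Λ]
    (Γ₀ : Submodule ℤ (EuclideanSpace ℝ (Fin d))) (hΓ₀ : IsOrthogonalLattice Γ₀)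
    (hG : (latticeSymmetryGroup Γ₀ :
        Set (EuclideanSpace ℝ (Fin d) ≃ₗᵢ[ℝ] EuclideanSpace ℝ (Fin d))) ⊆
      coincidenceIsometries Λ) :
    ∃ Γ : Submodule ℤ (EuclideanSpace ℝ (Fin d)),
      Γ ≤ Λ ∧ (∃ _ : DiscreteTopology Γ, IsZLattice ℝ Γ) ∧ IsWellRounded Γ := by
  obtain ⟨b, hb, rfl⟩ := hΓ₀
  choose r hr0 hr using fun i => exists_smul_mem_of_reflection_mem (b.ne_zero i)
    (hG (reflection_mem_latticeSymmetryGroup b hb i))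
  refine exists_isWellRounded_le_of_orthogonal Λ (fun i => r i • b i) hr (fun i j hij => ?_)
    (fun i => smul_ne_zero (hr0 i) (b.ne_zero i)) ?_
  · rw [real_inner_smul_left, real_inner_smul_right, hb i j hij, mul_zero, mul_zero]
  · rw [eq_top_iff, ← b.span_eq, Submodule.span_le]
    rintro _ ⟨i, rfl⟩
    rw [← inv_smul_smul₀ (hr0 i) (b i)]
    exact Submodule.smul_mem _ _ (Submodule.subset_span ⟨i, rfl⟩)
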